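/- **Conventions.** Fix a linearly ordered set $\mathrm{PROP}$ of proposition symbols, a subset $\mathrm{PROP}_1\subseteq\mathrm{PROP}$ of distinguished symbols, and a linearly ordered set $\mathrm{VAR}$ of schema variables. Let $\Pi\subseteq\mathrm{PROP}$ be finite and $\Delta\in\mathbb N$. *Models.* A Kripke model over $\Pi$ is $M=(W,R,V)$ with $W\neq\emptyset$, $R\subseteq W\times W$, $V:\Pi\to\mathcal P(W)$. The local input of $w\in W$ is the bit string of truth values at $w$ of the symbols of $\Pi$ (in the order of $\mathrm{PROP}$); the identifier of $w$ is the bit string of truth values of the symbols of $\Pi\cap\mathrm{PROP}_1$. Let $\mathcal K(\Pi,\Delta)$ be the class of finite Kripke models over $\Pi$ in which distinct nodes have distinct identifiers and every node has at most $\Delta$ successors. The neighbours of $w$ are its successors, ordered lexicographically by identifier. *Programs.* Schemata are given by $\varphi::=\top\mid p\mid X\mid\neg\varphi\mid(\varphi\wedge\varphi)\mid\Diamond\varphi$ with $p\in\Pi$ and $X$ a schema variable. A $\Pi$-program $\Lambda$ of $\mathrm{MSC}$ consists of a finite nonempty set $\mathcal T\subseteq\mathrm{VAR}$ of head predicates,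 for each $Y\in\mathcal T$ a terminal clause $Y(0):=\varphi_Y$ (with $\varphi_Y$ free of variables) and an iteration clause $Y:=\psi_Y$ (with variables of $\psi_Y$ in $\mathcal T$), and sets $\mathcal A,\mathcal P\subseteq\mathcal T$ of attention and print predicates. Put $Y^0=\varphi_Y$, and let $Y^{n+1}$ be $\psi_Y$ with each $X\in\mathcal T$ replaced by $X^n$. In round $n$ the state of $\Lambda$ at $w$ is the string of the truth values of the formulas $Y^n$ at $w$ (ordered by $\mathrm{VAR}$). The size of $\Lambda$ is the number of occurrences of proposition symbols, head predicates and $\top,\neg,\wedge,\Diamond$ in its clauses; its modal depth is the maximum nesting depth of $\Diamond$ in the bodies of its clauses. *Circuits.* A Boolean circuit is a finite directed acyclic graph of gates: unlabeled input gates of fan-in $0$, gates labeled $\wedge$ or $\vee$ of any fan-in (fan-in $0$ giving $1$, respectively $0$), and gates labeled $\neg$ of fan-in $1$; the output gates are the gates of fan-out $0$; input and output gates are ordered. Its size is its number of gates. A message passing circuit ($\mathrm{MPC}$) for $(\Pi,\Delta)$ is a circuit computing a function $\{0,1\}^{|\Pi|+k(\Delta+1)}\to\{0,1\}^k$ for some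 $k\in\mathbb N$, together with sets $A,P\subseteq\{1,\dots,k\}$ of attention and print bits. On $M\in\mathcal K(\Pi,\Delta)$, the state of node $w$ in round $0$ is the output of the circuit on the local input of $w$ followed by $0^{k(\Delta+1)}$; its state in round $n+1$ is the output on the local input of $w$, followed by the round-$n$ state of $w$, the round-$n$ states of the neighbours of $w$ in order, and $0^k$ for each missing neighbour. *Output.* A program or circuit outputs at $w$ in round $n$ if $n$ is the first round in which some attention bit of the state at $w$ is $1$; the output is then the string of print bits of the round-$n$ state, and the computation time at $w$ is the number $n+1$ of rounds $0,\dots,n$. A $\Pi$-program and an $\mathrm{MPC}$ for $(\Pi,\Delta)$ are equivalent if at every node of every model in $\mathcal K(\Pi,\Delta)$ they produce the same output, or neither produces any output. **Theorem.** There are absolute constants $c_1,c_2$ such that for all $\Pi$ and $\Delta$ and every $\Pi$-program $\Lambda$ of $\mathrm{MSC}$ of size $m$ and modal depth $d$ there is an $\mathrm{MPC}$ $C$ for $(\Pi,\Delta)$, equivalent to $\Lambda$, of size at most $c_1(\max(1,\Delta)\,m+|\Pi|)$, such that at every node of every model in $\mathcal K(\Pi,\Delta)$ where they produce an output, the computation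 time of $C$ is at most $c_2\max(1,d)$ times the computation time of $\Lambda$. In particular, for $\Delta\ge 1$ the size of $C$ is $\mathcal O(\Delta m+|\Pi|)$. -/

import Mathlib

namespace MSC

/-! ### Modal formulas, schemata and Kripke models -/

/-- Schemata of modal substitution calculus over proposition symbols from `P` and schema
variables from `T`. -/
inductive Schema (P T : Type) : Type where
  | top : Schema P T
  | prop : P → Schema P T
  | var : T → Schema P T
  | neg : Schema P T → Schema P T
  | conj : Schema P T → Schema P T → Schema P T
  | dia : Schema P T → Schema P T

/-- Modal formulas are the schemata without schema variables. -/
abbrev ML (P : Type) : Type := Schema P Empty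

/-- Simultaneous replacement of the schema variables by modal formulas. -/
def Schema.subst {P T : Type} (σ : T → ML P) : Schema P T → ML P
  | .top => .top
  | .prop p => .prop p
  | .var X => σ X
  | .neg φ => .neg (φ.subst σ)
  | .conj φ ψ => .conj (φ.subst σ) (ψ.subst σ)
  | .dia φ => .dia (φ.subst σ)

/-- Number of occurrences of proposition symbols, schema variables and operators. -/
def Schema.length {P T : Type} : Schema P T → ℕ
  | .top => 1
  | .prop _ => 1
  | .var _ => 1
  | .neg φ => φ.length + 1
  | .conj φ ψ => φ.length + ψ.length + 1
  | .dia φ => φ.length + 1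

/-- Maximum nesting depth of diamonds. -/
def Schema.modalDepth {P T : Type} : Schema P T → ℕ
  | .top => 0
  | .prop _ => 0
  | .var _ => 0
  | .neg φ => φ.modalDepth
  | .conj φ ψ => max φ.modalDepth ψ.modalDepth
  | .dia φ => φ.modalDepth + 1

/-- A Kripke model with domain `W` over the finite set `Sig` of proposition symbols. -/
structure KripkeModel {PROP : Type} (Sig : Finset PROP) (W : Type) where
  rel : W → W → Prop
  val : Sig → Set W

/-- Truth of a modal formula at a node. -/
def KripkeModel.Sat {PROP : Type} {Sig : Finset PROP} {W : Type} (M : KripkeModel Sig W) :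
    W → ML Sig → Prop
  | _, .top => True
  | w, .prop p => w ∈ M.val p
  | _, .var X => X.elim
  | w, .neg φ => ¬ M.Sat w φ
  | w, .conj φ ψ => M.Sat w φ ∧ M.Sat w ψ
  | w, .dia φ => ∃ v, M.rel w v ∧ M.Sat v φ

/-- The set of successors (neighbours) of a node. -/
def KripkeModel.succ {PROP : Type} {Sig : Finset PROP} {W : Type} (M : KripkeModel Sig W)
    (w : W) : Set W := {v | M.rel w v}

open Classical in
/-- The local input of a node: the bit string of the truth values of the proposition symbols. -/
noncomputable def KripkeModel.localInput {PROP : Type} {Sig : Finset PROP} {W : Type}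
    (M : KripkeModel Sig W) (w : W) : Sig → Bool :=
  fun p => decide (w ∈ M.val p)

/-- The identifier of a node: the bit string of the truth values of the distinguished proposition
symbols (those in `D`). Identifiers are compared lexicographically, the bit of the smallest
symbol being the first one. -/
noncomputable def KripkeModel.ident {PROP : Type} {Sig : Finset PROP} {W : Type}
    (M : KripkeModel Sig W) (D : Set PROP) (w : W) :
    Lex ({p : Sig // (p : PROP) ∈ D} → Bool) :=
  toLex fun p => M.localInput w p.1

/-- Finite Kripke models with identifiers and with all out-degrees at most `Δ`. -/
structure KripkeModel.InClass {PROP : Type} {Sig : Finset PROP} {W : Type}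
    (M : KripkeModel Sig W) (D : Set PROP) (Δ : ℕ) : Prop where
  nonempty : Nonempty W
  finite : Finite W
  identifiers : Function.Injective (M.ident D)
  outDegree : ∀ w, (M.succ w).ncard ≤ Δ

/-- `v` is the neighbour number `j` of `w` in the order of identifiers, counted from `0`. -/
def KripkeModel.IsNeighbour {PROP : Type} [LinearOrder PROP] {Sig : Finset PROP} {W : Type}
    (M : KripkeModel Sig W) (D : Set PROP) (w : W) (j : ℕ) (v : W) : Prop :=
  v ∈ M.succ w ∧ {u | u ∈ M.succ w ∧ M.ident D u < M.ident D v}.ncard = j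

/-! ### Acceptance and output of sequences of bit strings -/

/-- The sequence `S` of bit strings (with bit positions in `I`) accepts in round `n` with respect
to the attention positions `A`. -/
def AcceptsInRound {I : Type} (S : ℕ → I → Bool) (A : Finset I) (n : ℕ) : Prop :=
  (∃ i ∈ A, S n i = true) ∧ ∀ m < n, ∀ i ∈ A, S m i = false

/-- The substring of `b` with positions in `P`. -/
def substring {I : Type} [LinearOrder I] (P : Finset I) (b : I → Bool) : List Bool :=
  (P.sort (· ≤ ·)).map b

/-- The sequence `S` outputs the string `s` in round `n` with respect to the attention positions
`A` and the print positions `P`. -/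
def OutputsInRound {I : Type} [LinearOrder I] (S : ℕ → I → Bool) (A P : Finset I) (n : ℕ)
    (s : List Bool) : Prop :=
  AcceptsInRound S A n ∧ s = substring P (S n)

/-! ### Programs of modal substitution calculus -/

/-- A program over `Sig`: a finite nonempty set of head predicates, a terminal and an iteration
clause for each of them, and the sets of attention and print predicates. -/
structure Program {PROP : Type} (VAR : Type) (Sig : Finset PROP) where
  heads : Finset VAR
  heads_nonempty : heads.Nonempty
  terminal : heads → ML Sig
  iteration : heads → Schema Sig heads
  attention : Finset heads
  print : Finset heads

namespace Program

/-- The `n`th iteration formula of a head predicate. -/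
def iter {PROP VAR : Type} {Sig : Finset PROP} (Λ : Program VAR Sig) : ℕ → Λ.heads → ML Sig
  | 0 => Λ.terminal
  | n + 1 => fun Y => (Λ.iteration Y).subst (Λ.iter n)

/-- The number of occurrences of proposition symbols, head predicates and operators in the
program; every clause has, besides its body, one occurrence of its head predicate. -/
def length {PROP VAR : Type} {Sig : Finset PROP} (Λ : Program VAR Sig) : ℕ :=
  ∑ Y : Λ.heads, (((Λ.terminal Y).length + 1) + ((Λ.iteration Y).length + 1))

/-- The maximum modal depth of the bodies of the clauses. -/
def modalDepth {PROP VAR : Type} {Sig : Finset PROP} (Λ : Program VAR Sig) : ℕ :=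
  Finset.univ.sup fun Y : Λ.heads => max (Λ.terminal Y).modalDepth (Λ.iteration Y).modalDepth

open Classical in
/-- The global configuration of round `n`. -/
noncomputable def config {PROP VAR : Type} {Sig : Finset PROP} (Λ : Program VAR Sig) {W : Type}
    (M : KripkeModel Sig W) (n : ℕ) (w : W) : Λ.heads → Bool :=
  fun Y => decide (M.Sat w (Λ.iter n Y))

/-- The program outputs `s` at the node `w` in round `n`. The bits of the output are in the order
of the print predicates. -/
def Outputs {PROP VAR : Type} [LinearOrder VAR] {Sig : Finset PROP} (Λ : Program VAR Sig)
    {W : Type} (M : KripkeModel Sig W) (w : W) (n : ℕ) (s : List Bool) : Prop :=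
  OutputsInRound (fun t => Λ.config M t w) Λ.attention Λ.print n s

end Program

/-! ### Boolean circuits -/

/-- Labels of the gates that are not input gates. -/
inductive Op : Type where
  | and
  | or
  | not

/-- A Boolean circuit whose input gates are indexed by `ι` and whose output gates are indexed by
`κ`. `edge g h` means that the gate `g` feeds the gate `h`. The unlabeled gates are the input gates;
the output gates are exactly the gates of fan-out zero; `∧` and `∨` gates may have any fan-in. -/
structure Circuit (ι κ : Type) where
  Gate : Type
  fintypeGate : Fintype Gate
  edge : Gate → Gate → Prop
  acyclic : ∀ g, ¬ Relation.TransGen edge g g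
  label : Gate → Option Op
  input_fanIn : ∀ g, label g = none → ∀ h, ¬ edge h g
  not_fanIn : ∀ g, label g = some Op.not → ∃! h, edge h g
  input : ι ≃ {g : Gate // label g = none}
  output : κ ≃ {g : Gate // ∀ h, ¬ edge g h}

namespace Circuit

/-- The number of gates. -/
def size {ι κ : Type} (C : Circuit ι κ) : ℕ := @Fintype.card C.Gate C.fintypeGate

theorem wellFounded_edge {ι κ : Type} (C : Circuit ι κ) : WellFounded C.edge := by
  have := C.fintypeGate
  have : IsTrans C.Gate (Relation.TransGen C.edge) := ⟨fun _ _ _ => Relation.TransGen.trans⟩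
  have : Std.Irrefl (Relation.TransGen C.edge) := ⟨C.acyclic⟩
  exact Subrelation.wf (fun h => Relation.TransGen.single h)
    (Finite.wellFounded_of_trans_of_irrefl (Relation.TransGen C.edge))

open Classical in
/-- The value of a gate, given the values of the gates that feed it. -/
noncomputable def evalStep {ι κ : Type} (C : Circuit ι κ) (x : ι → Bool) (g : C.Gate)
    (rec : ∀ h, C.edge h g → Bool) : Bool :=
  match hg : C.label g with
  | none => x (C.input.symm ⟨g, hg⟩)
  | some .and => decide (∀ h (e : C.edge h g), rec h e = true)
  | some .or => decide (∃ h, ∃ e : C.edge h g, rec h e = true)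
  | some .not => decide (∀ h (e : C.edge h g), rec h e = false)

/-- The value of a gate on the input `x`. -/
noncomputable def eval {ι κ : Type} (C : Circuit ι κ) (x : ι → Bool) : C.Gate → Bool :=
  C.wellFounded_edge.fix (C.evalStep x)

/-- The function computed by the circuit. -/
noncomputable def run {ι κ : Type} (C : Circuit ι κ) (x : ι → Bool) : κ → Bool :=
  fun i => C.eval x (C.output i).1

end Circuit

/-! ### Message passing circuits -/

/-- A message passing circuit for `(Sig, Δ)` of state length `k`. Its input consists of one bit for
each symbol of `Sig` followed by `Δ + 1` strings of length `k`: the string number `0` is the node's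
own state, and the string number `j + 1` belongs to the neighbour number `j`. -/
structure MPC {PROP : Type} (Sig : Finset PROP) (Δ : ℕ) where
  k : ℕ
  circuit : Circuit (Sig ⊕ (Fin (Δ + 1) × Fin k)) (Fin k)
  attention : Finset (Fin k)
  print : Finset (Fin k)

namespace MPC

/-- The number of gates of the circuit. -/
def size {PROP : Type} {Sig : Finset PROP} {Δ : ℕ} (C : MPC Sig Δ) : ℕ := C.circuit.size

open Classical in
/-- The strings received by `w` when the current states are `f`: its own state, then the states of
its neighbours in the order of their identifiers, then zero strings for the missing neighbours. -/
noncomputable def received {PROP : Type} [LinearOrder PROP] {Sig : Finset PROP} {Δ : ℕ}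
    (C : MPC Sig Δ) {W : Type} (M : KripkeModel Sig W) (D : Set PROP) (f : W → Fin C.k → Bool)
    (w : W) : Fin (Δ + 1) → Fin C.k → Bool :=
  Fin.cons (f w) fun j => fun b => decide (∃ v, M.IsNeighbour D w j v ∧ f v b = true)

/-- The global configuration (the states of all the nodes) of round `n`. -/
noncomputable def config {PROP : Type} [LinearOrder PROP] {Sig : Finset PROP} {Δ : ℕ}
    (C : MPC Sig Δ) {W : Type} (M : KripkeModel Sig W) (D : Set PROP) :
    ℕ → W → Fin C.k → Bool
  | 0 => fun w => C.circuit.run (Sum.elim (M.localInput w) fun _ => false)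
  | n + 1 => fun w => C.circuit.run
      (Sum.elim (M.localInput w) fun jb => C.received M D (C.config M D n) w jb.1 jb.2)

/-- The circuit outputs `s` at the node `w` in round `n`. -/
def Outputs {PROP : Type} [LinearOrder PROP] {Sig : Finset PROP} {Δ : ℕ} (C : MPC Sig Δ)
    {W : Type} (M : KripkeModel Sig W) (D : Set PROP) (w : W) (n : ℕ) (s : List Bool) : Prop :=
  OutputsInRound (fun t => C.config M D t w) C.attention C.print n s

end MPC

/-- A program over `Sig` and a message passing circuit for `(Sig, Δ)` are equivalent: at every node
of every suitable model (a finite model over `Sig` with identifiers and out-degrees at most `Δ`)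
they produce the same output, or neither of them produces an output. -/
def Equivalent {PROP VAR : Type} [LinearOrder PROP] [LinearOrder VAR] {Sig : Finset PROP} {Δ : ℕ}
    (D : Set PROP) (Λ : Program VAR Sig) (C : MPC Sig Δ) : Prop :=
  ∀ (W : Type) (M : KripkeModel Sig W), M.InClass D Δ → ∀ (w : W) (s : List Bool),
    (∃ n, Λ.Outputs M w n s) ↔ ∃ n, C.Outputs M D w n s

/-- At every node of every suitable model where the program produces its output in round `n` and
the circuit produces its output in round `n'`, the number `n' + 1` of rounds computed by the circuit
is at most `c` times the number `n + 1` of rounds computed by the program. -/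
def TimeFactorAtMost {PROP VAR : Type} [LinearOrder PROP] [LinearOrder VAR] {Sig : Finset PROP}
    {Δ : ℕ} (D : Set PROP) (Λ : Program VAR Sig) (C : MPC Sig Δ) (c : ℕ) : Prop :=
  ∀ (W : Type) (M : KripkeModel Sig W), M.InClass D Δ → ∀ (w : W) (n n' : ℕ) (s s' : List Bool),
    Λ.Outputs M w n s → C.Outputs M D w n' s' → n' + 1 ≤ c * (n + 1)

end MSC

/-! The circuit stores at each node the truth values of all subschemata of clause bodies next to the
values of the head predicates. Boolean connectives are evaluated by gates within one round. A
diamond is the disjunction of one stored bit over all neighbour slots, so it lags one round behind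
its argument. Hence, while the head bits are frozen, the stored value of a subschema of modal depth
`t` is correct after `t + 1` rounds, and a phase of `d + 1` rounds evaluates every clause body,
where `d` is the modal depth of the program. Missing neighbours send zeros, which do not affect a
disjunction.

A unary clock of `d` bits counts the rounds of a phase. All nodes start from the zero state, so the
clocks agree everywhere. In the last round of a phase (the tick) the heads are overwritten: by the
terminal clauses in the first phase, by the iteration clauses afterwards. A flag distinguishes the
two cases. Attention is raised only at ticks, so intermediate states never cause an output, and
round `n` of the program is reproduced in round `n * (d + 1) + d` of the circuit
(`head_iff_and_sub_iff`, `outputs_toMPC_iff`). The time factor is therefore `d + 1 ≤ 2 * max 1 d`.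

The state length and the number of internal gates are linear in the program size `m`; the factor `Δ`
comes only from the `Δ + 1` input copies of the state. Gates of fan-out zero must be exactly the
outputs, so the construction is done with netlists and repaired once and for all by `toCircuit`: an
always true gate absorbs every wire and feeds every output conjunction. -/

namespace MSC

/-! ### Circuits from netlists -/

/-- The description of a gate in terms of the wires from `α` that feed it. -/
inductive GateDesc (α : Type) : Type where
  | all : Set α → GateDesc α
  | any : Set α → GateDesc α
  | not : α → GateDesc α

namespace GateDesc

/-- The wires that feed the gate. -/
def support {α : Type} : GateDesc α → Set α
  | all s => s
  | any s => s
  | not a => {a}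

/-- The label of the gate. -/
def op {α : Type} : GateDesc α → Op
  | all _ => .and
  | any _ => .or
  | not _ => .not

/-- The value of the gate when the values of the wires are given by `v`. -/
def Holds {α : Type} (v : α → Prop) : GateDesc α → Prop
  | all s => ∀ a ∈ s, v a
  | any s => ∃ a ∈ s, v a
  | not a => ¬ v a

end GateDesc

/-- A netlist with inputs `ι`, outputs `κ` and gates `G`. In contrast to circuits, every wire may be
an output, also several times, and wires may be unused. -/
structure Netlist (ι κ G : Type) where
  desc : G → GateDesc (ι ⊕ G)
  rank : G → ℕ
  rank_lt : ∀ g h, Sum.inr h ∈ (desc g).support → rank h < rank g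
  out : κ → ι ⊕ G

/-- The gates of the circuit of a netlist: the wires of the netlist, a constant gate, a gate that
absorbs all the wires and is always true, and the outputs. -/
inductive NetGate (ι κ G : Type) : Type where
  | wire : ι ⊕ G → NetGate ι κ G
  | one : NetGate ι κ G
  | absorb : NetGate ι κ G
  | out : κ → NetGate ι κ G

/-- The gates of the circuit of a netlist as a sum type. -/
def NetGate.equivSum (ι κ G : Type) : NetGate ι κ G ≃ (ι ⊕ G) ⊕ Bool ⊕ κ where
  toFun
    | wire a => .inl a
    | one => .inr (.inl true)
    | absorb => .inr (.inl false)
    | out k => .inr (.inr k)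
  invFun
    | .inl a => wire a
    | .inr (.inl true) => one
    | .inr (.inl false) => absorb
    | .inr (.inr k) => out k
  left_inv g := by cases g <;> rfl
  right_inv g := by rcases g with a | (_ | _) | k <;> rfl

namespace Netlist

variable {ι κ G : Type}

/-- The edges of the circuit of a netlist. -/
def edge (N : Netlist ι κ G) : NetGate ι κ G → NetGate ι κ G → Prop
  | .wire a, .wire (.inr g) => a ∈ (N.desc g).support
  | .wire _, .absorb => True
  | .one, .absorb => True
  | .absorb, .out _ => True
  | .wire a, .out k => a = N.out k
  | _, _ => False

/-- The labels of the circuit of a netlist. -/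
def label (N : Netlist ι κ G) : NetGate ι κ G → Option Op
  | .wire (.inl _) => none
  | .wire (.inr g) => some (N.desc g).op
  | .one => some .and
  | .absorb => some .or
  | .out _ => some .and

/-- A rank function that increases along the edges of the circuit of a netlist. -/
def gateRank [Fintype G] (N : Netlist ι κ G) : NetGate ι κ G → ℕ
  | .wire (.inl _) => 0
  | .wire (.inr g) => N.rank g + 1
  | .one => 0
  | .absorb => Finset.univ.sup N.rank + 2
  | .out _ => Finset.univ.sup N.rank + 3

theorem gateRank_lt [Fintype G] (N : Netlist ι κ G) {a b : NetGate ι κ G} (h : N.edge a b) :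
    N.gateRank a < N.gateRank b := by
  -- Every wire has rank at most the supremum plus one, hence lies strictly below the absorbing gate
  -- and the outputs.
  have hs : ∀ g, N.rank g ≤ Finset.univ.sup N.rank := fun g => Finset.le_sup (Finset.mem_univ g)
  rcases a with (i | g) | _ | _ | k <;> rcases b with (i' | g') | _ | _ | k' <;>
    simp only [edge, gateRank] at h ⊢
  all_goals first
    | omega
    | (have := hs g; omega)
    | (have := N.rank_lt _ _ h; omega)

/-- The circuit of a netlist. -/
def toCircuit [Fintype ι] [Fintype κ] [Nonempty κ] [Fintype G] (N : Netlist ι κ G) :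
    Circuit ι κ where
  Gate := NetGate ι κ G
  fintypeGate := Fintype.ofEquiv _ (NetGate.equivSum ι κ G).symm
  edge := N.edge
  acyclic g hg := by
    have key : ∀ a b, Relation.TransGen N.edge a b → N.gateRank a < N.gateRank b := by
      intro a b h
      induction h with
      | single h => exact N.gateRank_lt h
      | tail _ h ih => exact ih.trans (N.gateRank_lt h)
    exact lt_irrefl _ (key g g hg)
  label := N.label
  input_fanIn g hg h := by
    rcases g with (i | g) | _ | _ | k <;> rcases h with (i' | g') | _ | _ | k' <;>
      simp_all [label, edge]
  not_fanIn g hg := by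
    rcases g with (i | g) | _ | _ | k
    · simp [label] at hg
    · cases hd : N.desc g with
      | all s => simp [label, hd, GateDesc.op] at hg
      | any s => simp [label, hd, GateDesc.op] at hg
      | not a =>
        refine ⟨.wire a, by simp [edge, hd, GateDesc.support], ?_⟩
        intro h hh
        rcases h with a' | _ | _ | k <;> simp_all [edge, GateDesc.support]
    · simp [label] at hg
    · simp [label] at hg
    · simp [label] at hg
  input :=
    { toFun := fun i => ⟨.wire (.inl i), rfl⟩
      invFun := fun g => match g with
        | ⟨.wire (.inl i), _⟩ => i
      left_inv := fun _ => rfl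
      right_inv := fun g => match g with
        | ⟨.wire (.inl _), _⟩ => rfl }
  -- Wires and the constant gate feed the absorbing gate, and the absorbing gate feeds some output
  -- because `κ` is nonempty; so only output gates have fan-out zero.
  output :=
    { toFun := fun k => ⟨.out k, fun h => by rcases h with (i' | g') | _ | _ | k' <;> simp [edge]⟩
      invFun := fun g => match g with
        | ⟨.out k, _⟩ => k
        | ⟨.wire a, h⟩ => (h .absorb trivial).elim
        | ⟨.one, h⟩ => (h .absorb trivial).elim
        | ⟨.absorb, h⟩ => (h (.out (Classical.arbitrary κ)) trivial).elim
      left_inv := fun _ => rfl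
      right_inv := fun g => match g with
        | ⟨.out k, _⟩ => rfl
        | ⟨.wire a, h⟩ => (h .absorb trivial).elim
        | ⟨.one, h⟩ => (h .absorb trivial).elim
        | ⟨.absorb, h⟩ => (h (.out (Classical.arbitrary κ)) trivial).elim }

theorem size_toCircuit [Fintype ι] [Fintype κ] [Nonempty κ] [Fintype G] (N : Netlist ι κ G) :
    N.toCircuit.size = Fintype.card ι + Fintype.card G + 2 + Fintype.card κ := by
  have : N.toCircuit.size = Fintype.card ((ι ⊕ G) ⊕ Bool ⊕ κ) :=
    @Fintype.card_congr _ _ (Fintype.ofEquiv _ (NetGate.equivSum ι κ G).symm) _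
      (NetGate.equivSum ι κ G)
  rw [this]
  simp only [Fintype.card_sum, Fintype.card_bool]
  ring

end Netlist

/-! ### Values of the gates in the circuit of a netlist -/

namespace Circuit

variable {ι κ : Type} (C : Circuit ι κ) (x : ι → Bool)

theorem eval_eq (g : C.Gate) : C.eval x g = C.evalStep x g fun h _ => C.eval x h :=
  C.wellFounded_edge.fix_eq _ _

theorem eval_of_none {g : C.Gate} (hg : C.label g = none) :
    C.eval x g = x (C.input.symm ⟨g, hg⟩) := by
  rw [eval_eq, evalStep]
  split <;> simp_all

theorem eval_of_and {g : C.Gate} (hg : C.label g = some .and) :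
    C.eval x g = true ↔ ∀ h, C.edge h g → C.eval x h = true := by
  rw [eval_eq, evalStep]
  split <;> simp_all

theorem eval_of_or {g : C.Gate} (hg : C.label g = some .or) :
    C.eval x g = true ↔ ∃ h, C.edge h g ∧ C.eval x h = true := by
  rw [eval_eq, evalStep]
  split <;> simp_all

theorem eval_of_not {g : C.Gate} (hg : C.label g = some .not) :
    C.eval x g = true ↔ ∀ h, C.edge h g → ¬ C.eval x h = true := by
  rw [eval_eq, evalStep]
  split <;> simp_all

end Circuit

namespace Netlist

variable {ι κ G : Type} [Fintype ι] [Fintype κ] [Nonempty κ] [Fintype G]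

theorem eval_wire_inl (N : Netlist ι κ G) (x : ι → Bool) (i : ι) :
    N.toCircuit.eval x (.wire (.inl i)) = x i :=
  N.toCircuit.eval_of_none x (g := .wire (.inl i)) rfl

theorem eval_wire_inr (N : Netlist ι κ G) (x : ι → Bool) (g : G) :
    N.toCircuit.eval x (.wire (.inr g)) = true ↔
      (N.desc g).Holds fun a => N.toCircuit.eval x (.wire a) = true := by
  have hl : N.toCircuit.label (.wire (.inr g)) = some (N.desc g).op := rfl
  have he : ∀ h, N.toCircuit.edge h (.wire (.inr g)) ↔ ∃ a ∈ (N.desc g).support, h = .wire a := by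
    intro h
    change N.edge h (.wire (.inr g)) ↔ _
    rcases h with a | _ | _ | k
    · exact ⟨fun h => ⟨a, h, rfl⟩, by rintro ⟨b, hb, hab⟩; cases hab; exact hb⟩
    all_goals simp [edge]
  cases hd : N.desc g with
  | all s =>
    rw [hd] at hl he
    rw [N.toCircuit.eval_of_and x hl]
    simp only [he, GateDesc.support, GateDesc.Holds]
    exact ⟨fun h a ha => h _ ⟨a, ha, rfl⟩, by rintro h _ ⟨a, ha, rfl⟩; exact h a ha⟩
  | any s =>
    rw [hd] at hl he
    rw [N.toCircuit.eval_of_or x hl]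
    simp only [he, GateDesc.support, GateDesc.Holds]
    exact ⟨by rintro ⟨_, ⟨a, ha, rfl⟩, h⟩; exact ⟨a, ha, h⟩, by
      rintro ⟨a, ha, h⟩; exact ⟨_, ⟨a, ha, rfl⟩, h⟩⟩
  | not b =>
    rw [hd] at hl he
    rw [N.toCircuit.eval_of_not x hl]
    simp only [he, GateDesc.support, GateDesc.Holds]
    exact ⟨fun h => h _ ⟨b, rfl, rfl⟩, by rintro h _ ⟨a, rfl, rfl⟩; exact h⟩

/-- The disjunction contains the constant gate, an empty conjunction. -/
theorem eval_absorb (N : Netlist ι κ G) (x : ι → Bool) : N.toCircuit.eval x .absorb = true := by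
  rw [N.toCircuit.eval_of_or x (g := .absorb) rfl]
  refine ⟨.one, trivial, ?_⟩
  rw [N.toCircuit.eval_of_and x (g := .one) rfl]
  intro h (hh : N.edge h .one)
  rcases h with (i | g) | _ | _ | k <;> exact hh.elim

/-- An output is the conjunction of its wire with the absorbing gate, and the second conjunct is
always true. -/
theorem run_toCircuit (N : Netlist ι κ G) (x : ι → Bool) (k : κ) :
    N.toCircuit.run x k = N.toCircuit.eval x (.wire (N.out k)) := by
  change N.toCircuit.eval x (.out k) = _
  rw [Bool.eq_iff_iff, N.toCircuit.eval_of_and x (g := .out k) rfl]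
  refine ⟨fun h => h (.wire (N.out k)) (show N.edge (.wire _) (.out k) from rfl), ?_⟩
  intro h a (ha : N.edge a (.out k))
  rcases a with a | _ | _ | k'
  · rw [show a = N.out k from ha]
    exact h
  · exact ha.elim
  · exact N.eval_absorb x
  · exact ha.elim

/-- The circuit of a netlist computes a solution of the equations of its gates. -/
theorem exists_run_toCircuit (N : Netlist ι κ G) (x : ι → Bool) :
    ∃ v : G → Prop, (∀ g, v g ↔ (N.desc g).Holds (Sum.elim (fun i => x i = true) v)) ∧
      ∀ k, N.toCircuit.run x k = true ↔ Sum.elim (fun i => x i = true) v (N.out k) := by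
  have h : (fun a => N.toCircuit.eval x (.wire a) = true) =
      Sum.elim (fun i => x i = true) fun g => N.toCircuit.eval x (.wire (.inr g)) = true := by
    funext a
    rcases a with i | g
    · simp [eval_wire_inl]
    · rfl
  refine ⟨fun g => N.toCircuit.eval x (.wire (.inr g)) = true, fun g => ?_, fun k => ?_⟩
  · rw [← h]
    exact N.eval_wire_inr x g
  · rw [← h, run_toCircuit]

end Netlist

/-! ### Subschemata -/

namespace Schema

variable {P T : Type}

/-- A modal formula as a schema. -/
def ofML : ML P → Schema P T
  | .top => .top
  | .prop p => .prop p
  | .var X => X.elim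
  | .neg φ => .neg (ofML φ)
  | .conj φ ψ => .conj (ofML φ) (ofML ψ)
  | .dia φ => .dia (ofML φ)

theorem length_ofML (φ : ML P) : (ofML φ : Schema P T).length = φ.length := by
  induction φ with
  | var X => exact X.elim
  | _ => simp_all [ofML, length]

theorem modalDepth_ofML (φ : ML P) : (ofML φ : Schema P T).modalDepth = φ.modalDepth := by
  induction φ with
  | var X => exact X.elim
  | _ => simp_all [ofML, modalDepth]

theorem modalDepth_le_length (φ : Schema P T) : φ.modalDepth ≤ φ.length := by
  induction φ with
  | conj φ ψ hφ hψ => simp only [modalDepth, length]; omega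
  | _ => simp only [modalDepth, length]; omega

noncomputable instance : DecidableEq (Schema P T) := Classical.decEq _

/-- The subschemata of a schema. -/
noncomputable def subs : Schema P T → Finset (Schema P T)
  | .top => {.top}
  | .prop p => {.prop p}
  | .var X => {.var X}
  | .neg φ => insert (.neg φ) φ.subs
  | .conj φ ψ => insert (.conj φ ψ) (φ.subs ∪ ψ.subs)
  | .dia φ => insert (.dia φ) φ.subs

theorem self_mem_subs (φ : Schema P T) : φ ∈ φ.subs := by
  cases φ <;> simp [subs]

theorem subs_subset {φ χ : Schema P T} (h : φ ∈ χ.subs) : φ.subs ⊆ χ.subs := by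
  induction χ with
  | top => rw [subs, Finset.mem_singleton] at h; rw [h]
  | prop p => rw [subs, Finset.mem_singleton] at h; rw [h]
  | var X => rw [subs, Finset.mem_singleton] at h; rw [h]
  | neg ψ ih =>
    rcases Finset.mem_insert.1 h with rfl | h
    · rfl
    · exact (ih h).trans (Finset.subset_insert _ _)
  | dia ψ ih =>
    rcases Finset.mem_insert.1 h with rfl | h
    · rfl
    · exact (ih h).trans (Finset.subset_insert _ _)
  | conj ψ₁ ψ₂ ih₁ ih₂ =>
    rcases Finset.mem_insert.1 h with rfl | h
    · rfl
    · refine Finset.Subset.trans ?_ (Finset.subset_insert _ _)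
      rcases Finset.mem_union.1 h with h | h
      · exact (ih₁ h).trans Finset.subset_union_left
      · exact (ih₂ h).trans Finset.subset_union_right

theorem card_subs_le (φ : Schema P T) : φ.subs.card ≤ φ.length := by
  induction φ with
  | neg φ ih => exact (Finset.card_insert_le _ _).trans (by simpa [length] using ih)
  | dia φ ih => exact (Finset.card_insert_le _ _).trans (by simpa [length] using ih)
  | conj φ ψ ih₁ ih₂ =>
    refine (Finset.card_insert_le _ _).trans ?_
    have := Finset.card_union_le φ.subs ψ.subs
    simp only [length]
    omega
  | _ => simp [subs, length]

/-- Truth of a schema when the truth values of the schema variables are given by `H`. -/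
def Holds {PROP T W : Type} {Sig : Finset PROP} (M : KripkeModel Sig W) (H : W → T → Prop) :
    W → Schema Sig T → Prop
  | _, .top => True
  | w, .prop p => w ∈ M.val p
  | w, .var X => H w X
  | w, .neg φ => ¬ Holds M H w φ
  | w, .conj φ ψ => Holds M H w φ ∧ Holds M H w ψ
  | w, .dia φ => ∃ v, M.rel w v ∧ Holds M H v φ

section

variable {PROP W : Type} {Sig : Finset PROP} (M : KripkeModel Sig W)

/-- This replaces the growing iteration formulas by the fixed clause bodies, evaluated under the
truth values of the previous round. -/
theorem sat_subst (σ : T → ML Sig) (w : W) (φ : Schema Sig T) :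
    M.Sat w (φ.subst σ) ↔ Holds M (fun v X => M.Sat v (σ X)) w φ := by
  induction φ generalizing w with
  | _ => simp_all [subst, KripkeModel.Sat, Holds]

/-- Terminal clauses contain no variables, so whatever the head bits hold during the first phase is
harmless. -/
theorem holds_ofML (H : W → T → Prop) (w : W) (φ : ML Sig) :
    Holds M H w (ofML φ) ↔ M.Sat w φ := by
  induction φ generalizing w with
  | var X => exact X.elim
  | _ => simp_all [ofML, KripkeModel.Sat, Holds]

end

end Schema

namespace Program

variable {PROP VAR : Type} {Sig : Finset PROP}

/-! ### The state of the circuit that simulates a program -/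

/-- The subschemata of the bodies of the clauses. -/
noncomputable def closure (Λ : Program VAR Sig) : Finset (Schema Sig Λ.heads) :=
  Finset.univ.biUnion fun Y => (Schema.ofML (Λ.terminal Y)).subs ∪ (Λ.iteration Y).subs

theorem mem_closure {Λ : Program VAR Sig} {φ : Schema Sig Λ.heads} :
    φ ∈ Λ.closure ↔
      ∃ Y, φ ∈ (Schema.ofML (Λ.terminal Y)).subs ∨ φ ∈ (Λ.iteration Y).subs := by
  simp [closure]

theorem subs_subset_closure {Λ : Program VAR Sig} {φ : Schema Sig Λ.heads} (h : φ ∈ Λ.closure) :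
    φ.subs ⊆ Λ.closure := by
  intro ψ hψ
  obtain ⟨Y, hY⟩ := mem_closure.1 h
  exact mem_closure.2 ⟨Y, hY.imp (fun h => Schema.subs_subset h hψ)
    fun h => Schema.subs_subset h hψ⟩

theorem mem_closure_of_neg {Λ : Program VAR Sig} {φ : Schema Sig Λ.heads}
    (h : φ.neg ∈ Λ.closure) : φ ∈ Λ.closure :=
  subs_subset_closure h (Finset.mem_insert_of_mem φ.self_mem_subs)

theorem mem_closure_of_dia {Λ : Program VAR Sig} {φ : Schema Sig Λ.heads}
    (h : φ.dia ∈ Λ.closure) : φ ∈ Λ.closure :=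
  subs_subset_closure h (Finset.mem_insert_of_mem φ.self_mem_subs)

theorem mem_closure_of_conj_left {Λ : Program VAR Sig} {φ ψ : Schema Sig Λ.heads}
    (h : φ.conj ψ ∈ Λ.closure) : φ ∈ Λ.closure :=
  subs_subset_closure h
    (Finset.mem_insert_of_mem (Finset.mem_union_left _ φ.self_mem_subs))

theorem mem_closure_of_conj_right {Λ : Program VAR Sig} {φ ψ : Schema Sig Λ.heads}
    (h : φ.conj ψ ∈ Λ.closure) : ψ ∈ Λ.closure :=
  subs_subset_closure h
    (Finset.mem_insert_of_mem (Finset.mem_union_right _ ψ.self_mem_subs))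

theorem terminal_mem_closure (Λ : Program VAR Sig) (Y : Λ.heads) :
    Schema.ofML (Λ.terminal Y) ∈ Λ.closure :=
  mem_closure.2 ⟨Y, .inl (Schema.self_mem_subs _)⟩

theorem iteration_mem_closure (Λ : Program VAR Sig) (Y : Λ.heads) :
    Λ.iteration Y ∈ Λ.closure :=
  mem_closure.2 ⟨Y, .inr (Schema.self_mem_subs _)⟩

theorem card_closure_le (Λ : Program VAR Sig) : Λ.closure.card ≤ Λ.length := by
  refine Finset.card_biUnion_le.trans (Finset.sum_le_sum fun Y _ => ?_)
  refine (Finset.card_union_le _ _).trans ?_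
  have h₁ := (Schema.ofML (T := Λ.heads) (Λ.terminal Y)).card_subs_le
  have h₂ := (Λ.iteration Y).card_subs_le
  rw [Schema.length_ofML] at h₁
  omega

theorem card_heads_le (Λ : Program VAR Sig) : Λ.heads.card ≤ Λ.length := by
  have : ∑ _Y : Λ.heads, 1 ≤ Λ.length := Finset.sum_le_sum fun Y _ => by omega
  simpa using this

theorem terminal_modalDepth_le (Λ : Program VAR Sig) (Y : Λ.heads) :
    (Λ.terminal Y).modalDepth ≤ Λ.modalDepth :=
  (le_max_left _ _).trans (Finset.le_sup (f := fun Y : Λ.heads =>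
    max (Λ.terminal Y).modalDepth (Λ.iteration Y).modalDepth) (Finset.mem_univ Y))

theorem iteration_modalDepth_le (Λ : Program VAR Sig) (Y : Λ.heads) :
    (Λ.iteration Y).modalDepth ≤ Λ.modalDepth :=
  (le_max_right _ _).trans (Finset.le_sup (f := fun Y : Λ.heads =>
    max (Λ.terminal Y).modalDepth (Λ.iteration Y).modalDepth) (Finset.mem_univ Y))

theorem modalDepth_le_length (Λ : Program VAR Sig) : Λ.modalDepth ≤ Λ.length := by
  refine Finset.sup_le fun Y _ => ?_
  have h₁ := (Λ.terminal Y).modalDepth_le_length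
  have h₂ := (Λ.iteration Y).modalDepth_le_length
  have h₃ : ((Λ.terminal Y).length + 1) + ((Λ.iteration Y).length + 1) ≤ Λ.length :=
    Finset.single_le_sum (f := fun Y : Λ.heads =>
      ((Λ.terminal Y).length + 1) + ((Λ.iteration Y).length + 1)) (fun _ _ => Nat.zero_le _)
      (Finset.mem_univ Y)
  omega

theorem length_pos (Λ : Program VAR Sig) : 0 < Λ.length :=
  (Finset.card_pos.2 Λ.heads_nonempty).trans_le Λ.card_heads_le

/-- The bits of the state of the simulating circuit other than those of the head predicates: the
truth values of the subschemata, the clock in unary notation, and two flags. The flag `false` says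
that the terminal clauses have been evaluated, and the flag `true` asks for attention. -/
abbrev AuxBit (Λ : Program VAR Sig) : Type := Λ.closure ⊕ Fin Λ.modalDepth ⊕ Bool

/-- The bits of the state of the simulating circuit. -/
abbrev StateBit (Λ : Program VAR Sig) : Type := Λ.heads ⊕ Λ.AuxBit

/-- The number of bits of the state of the simulating circuit. -/
noncomputable def stateLength (Λ : Program VAR Sig) : ℕ :=
  Λ.heads.card + Fintype.card Λ.AuxBit

theorem stateLength_eq (Λ : Program VAR Sig) :
    Λ.stateLength = Λ.heads.card + (Λ.closure.card + (Λ.modalDepth + 2)) := by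
  simp [stateLength]

theorem stateLength_pos (Λ : Program VAR Sig) : 0 < Λ.stateLength := by
  rw [stateLength_eq]
  omega

/-- The enumeration of the bits of the state, in which the head predicates keep their order. -/
noncomputable def bitEquiv [LinearOrder VAR] (Λ : Program VAR Sig) :
    Λ.StateBit ≃ Fin Λ.stateLength :=
  (Equiv.sumCongr (Λ.heads.orderIsoOfFin rfl).symm.toEquiv (Fintype.equivFin Λ.AuxBit)).trans
    finSumFinEquiv

/-- Order preservation makes the printed string of the circuit list the print predicates in their
own order. -/
theorem bitEquiv_inl_strictMono [LinearOrder VAR] (Λ : Program VAR Sig) :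
    StrictMono fun Y : Λ.heads => Λ.bitEquiv (.inl Y) := by
  intro X Y h
  exact (Fin.strictMono_castAdd _) ((Λ.heads.orderIsoOfFin rfl).symm.strictMono h)

/-! ### The simulating circuit -/

/-- The gates of the simulating circuit. -/
inductive SimGate (Λ : Program VAR Sig) : Type where
  | sub : Λ.closure → SimGate Λ
  | clock : Fin Λ.modalDepth → SimGate Λ
  | tick : SimGate Λ
  | notTick : SimGate Λ
  | started : SimGate Λ
  | notStarted : SimGate Λ
  | anyAttention : SimGate Λ
  | attention : SimGate Λ
  | terminal : Λ.heads → SimGate Λ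
  | iteration : Λ.heads → SimGate Λ
  | keep : Λ.heads → SimGate Λ
  | head : Λ.heads → SimGate Λ

/-- The gates of the simulating circuit as a sum type. -/
def SimGate.equivSum (Λ : Program VAR Sig) :
    SimGate Λ ≃ (Λ.closure ⊕ Fin Λ.modalDepth) ⊕ Fin 6 ⊕ (Λ.heads × Fin 4) where
  toFun
    | sub φ => .inl (.inl φ)
    | clock i => .inl (.inr i)
    | tick => .inr (.inl 0)
    | notTick => .inr (.inl 1)
    | started => .inr (.inl 2)
    | notStarted => .inr (.inl 3)
    | anyAttention => .inr (.inl 4)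
    | attention => .inr (.inl 5)
    | terminal Y => .inr (.inr (Y, 0))
    | iteration Y => .inr (.inr (Y, 1))
    | keep Y => .inr (.inr (Y, 2))
    | head Y => .inr (.inr (Y, 3))
  invFun
    | .inl (.inl φ) => sub φ
    | .inl (.inr i) => clock i
    | .inr (.inl 0) => tick
    | .inr (.inl 1) => notTick
    | .inr (.inl 2) => started
    | .inr (.inl 3) => notStarted
    | .inr (.inl 4) => anyAttention
    | .inr (.inl 5) => attention
    | .inr (.inr (Y, 0)) => terminal Y
    | .inr (.inr (Y, 1)) => iteration Y
    | .inr (.inr (Y, 2)) => keep Y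
    | .inr (.inr (Y, 3)) => head Y
  left_inv g := by cases g <;> rfl
  right_inv g := by
    rcases g with (φ | i) | i | ⟨Y, i⟩
    · rfl
    · rfl
    · fin_cases i <;> rfl
    · fin_cases i <;> rfl

noncomputable instance (Λ : Program VAR Sig) : Fintype (SimGate Λ) :=
  Fintype.ofEquiv _ (SimGate.equivSum Λ).symm

theorem card_simGate (Λ : Program VAR Sig) :
    Fintype.card (SimGate Λ) = Λ.closure.card + Λ.modalDepth + (6 + Λ.heads.card * 4) := by
  rw [Fintype.card_congr (SimGate.equivSum Λ)]
  simp

section Simulation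

variable [LinearOrder VAR] (Λ : Program VAR Sig) (Δ : ℕ)

/-- The wires of the simulating circuit. -/
abbrev Wire : Type := (Sig ⊕ (Fin (Δ + 1) × Fin Λ.stateLength)) ⊕ SimGate Λ

/-- The wire with a bit of the own state of the node. -/
noncomputable def ownWire (b : Λ.StateBit) : Λ.Wire Δ := .inl (.inr (0, Λ.bitEquiv b))

/-- The wire with a bit of the state of a neighbour. -/
noncomputable def neighbourWire (j : Fin Δ) (b : Λ.StateBit) : Λ.Wire Δ :=
  .inl (.inr (j.succ, Λ.bitEquiv b))

/-- The gate of a subschema. The modal subschemata refer to the previous round. -/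
noncomputable def subDesc : Λ.closure → GateDesc (Λ.Wire Δ)
  | ⟨.top, _⟩ => .all ∅
  | ⟨.prop p, _⟩ => .any {.inl (.inl p)}
  | ⟨.var X, _⟩ => .any {Λ.ownWire Δ (.inl X)}
  | ⟨.neg φ, h⟩ => .not (.inr (.sub ⟨φ, mem_closure_of_neg h⟩))
  | ⟨.conj φ ψ, h⟩ => .all {.inr (.sub ⟨φ, mem_closure_of_conj_left h⟩),
      .inr (.sub ⟨ψ, mem_closure_of_conj_right h⟩)}
  | ⟨.dia φ, h⟩ =>
      .any (Set.range fun j => Λ.neighbourWire Δ j (.inr (.inl ⟨φ, mem_closure_of_dia h⟩)))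

/-- The gates of the simulating circuit. Every round of the program takes `Λ.modalDepth + 1` rounds
of the circuit, and the gate `tick` is true in the last of them. -/
noncomputable def simDesc : SimGate Λ → GateDesc (Λ.Wire Δ)
  | .sub φ => Λ.subDesc Δ φ
  | .clock i => .all (insert (.inr .notTick)
      (Set.image (fun j => Λ.ownWire Δ (.inr (.inr (.inl j)))) {j | j < i}))
  | .tick => .all (Set.range fun i => Λ.ownWire Δ (.inr (.inr (.inl i))))
  | .notTick => .not (.inr .tick)
  | .started => .any {.inr .tick, Λ.ownWire Δ (.inr (.inr (.inr false)))}
  | .notStarted => .not (Λ.ownWire Δ (.inr (.inr (.inr false))))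
  | .anyAttention => .any (Set.image (fun Y => .inr (.head Y)) {Y | Y ∈ Λ.attention})
  | .attention => .all {.inr .tick, .inr .anyAttention}
  | .terminal Y => .all {.inr .tick, .inr .notStarted,
      .inr (.sub ⟨_, Λ.terminal_mem_closure Y⟩)}
  | .iteration Y => .all {.inr .tick, Λ.ownWire Δ (.inr (.inr (.inr false))),
      .inr (.sub ⟨_, Λ.iteration_mem_closure Y⟩)}
  | .keep Y => .all {.inr .notTick, Λ.ownWire Δ (.inl Y)}
  | .head Y => .any {.inr (.terminal Y), .inr (.iteration Y), .inr (.keep Y)}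

/-- The rank of a gate of the simulating circuit. -/
noncomputable def simRank : SimGate Λ → ℕ
  | .sub φ => φ.1.length
  | .clock _ => 2
  | .tick => 0
  | .notTick => 1
  | .started => 1
  | .notStarted => 0
  | .anyAttention => Λ.closure.sup Schema.length + 4
  | .attention => Λ.closure.sup Schema.length + 5
  | .terminal _ => Λ.closure.sup Schema.length + 2
  | .iteration _ => Λ.closure.sup Schema.length + 2
  | .keep _ => Λ.closure.sup Schema.length + 2
  | .head _ => Λ.closure.sup Schema.length + 3

/-- Among the subschema gates, only negations and conjunctions read other gates, and these belong to
shorter schemata; variables and diamonds read only input bits. The remaining gates that read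
subschemata are placed above the greatest length. -/
theorem simRank_lt (g h : SimGate Λ) (hg : .inr h ∈ (Λ.simDesc Δ g).support) :
    Λ.simRank h < Λ.simRank g := by
  have hs : ∀ φ ∈ Λ.closure, φ.length ≤ Λ.closure.sup Schema.length :=
    fun φ hφ => Finset.le_sup hφ
  cases g with
  | sub φ =>
    obtain ⟨φ, hφ⟩ := φ
    cases φ with
    | conj φ ψ =>
      simp only [simDesc, subDesc, GateDesc.support, Set.mem_insert_iff, Set.mem_singleton_iff,
        Sum.inr.injEq] at hg
      rcases hg with rfl | rfl <;> simp only [simRank, Schema.length] <;> omega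
    | neg φ =>
      simp only [simDesc, subDesc, GateDesc.support, Set.mem_singleton_iff, Sum.inr.injEq] at hg
      subst hg
      simp [simRank, Schema.length]
    | _ => simp [simDesc, subDesc, GateDesc.support, ownWire, neighbourWire] at hg
  | terminal Y =>
    have := hs _ (Λ.terminal_mem_closure Y)
    simp only [simDesc, GateDesc.support, Set.mem_insert_iff, Set.mem_singleton_iff,
      Sum.inr.injEq] at hg
    rcases hg with rfl | rfl | rfl <;> simp only [simRank] <;> omega
  | iteration Y =>
    have := hs _ (Λ.iteration_mem_closure Y)
    simp only [simDesc, GateDesc.support, ownWire, Set.mem_insert_iff, Set.mem_singleton_iff,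
      Sum.inr.injEq, reduceCtorEq, false_or] at hg
    rcases hg with rfl | rfl <;> simp only [simRank] <;> omega
  | tick => simp [simDesc, GateDesc.support, ownWire] at hg
  | notStarted => simp [simDesc, GateDesc.support, ownWire] at hg
  | _ =>
    simp only [simDesc, GateDesc.support, ownWire, Set.mem_insert_iff, Set.mem_singleton_iff,
      Sum.inr.injEq, Set.mem_image, reduceCtorEq, and_false, exists_false,
      or_false] at hg
    first
    | (subst hg; simp [simRank])
    | (rcases hg with rfl | rfl <;> simp [simRank])
    | (rcases hg with rfl | rfl | rfl <;> simp [simRank])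
    | (obtain ⟨Y, -, rfl⟩ := hg; simp [simRank])

/-- The gate that computes a bit of the state. -/
def bitGate : Λ.StateBit → SimGate Λ
  | .inl Y => .head Y
  | .inr (.inl φ) => .sub φ
  | .inr (.inr (.inl i)) => .clock i
  | .inr (.inr (.inr false)) => .started
  | .inr (.inr (.inr true)) => .attention

/-- The netlist of the simulating circuit. -/
noncomputable def simNetlist :
    Netlist (Sig ⊕ (Fin (Δ + 1) × Fin Λ.stateLength)) (Fin Λ.stateLength) (SimGate Λ) where
  desc := Λ.simDesc Δ
  rank := Λ.simRank
  rank_lt := Λ.simRank_lt Δ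
  out b := .inr (Λ.bitGate (Λ.bitEquiv.symm b))

/-- The simulating circuit. -/
noncomputable def toMPC : MPC Sig Δ where
  k := Λ.stateLength
  circuit :=
    have : Nonempty (Fin Λ.stateLength) := ⟨⟨0, Λ.stateLength_pos⟩⟩
    (Λ.simNetlist Δ).toCircuit
  attention := {Λ.bitEquiv (.inr (.inr (.inr true)))}
  print := Λ.print.map ⟨_, Λ.bitEquiv_inl_strictMono.injective⟩

theorem size_toMPC_le : (Λ.toMPC Δ).size ≤ 40 * (max 1 Δ * Λ.length + Sig.card) := by
  have : Nonempty (Fin Λ.stateLength) := ⟨⟨0, Λ.stateLength_pos⟩⟩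
  have h : (Λ.toMPC Δ).size = _ := (Λ.simNetlist Δ).size_toCircuit
  rw [h, card_simGate]
  simp only [Fintype.card_sum, Fintype.card_prod, Fintype.card_fin, Fintype.card_coe]
  have h₁ := Λ.stateLength_eq
  have h₂ := Λ.card_closure_le
  have h₃ := Λ.card_heads_le
  have h₄ := Λ.modalDepth_le_length
  have h₅ := Λ.length_pos
  -- Heads, closure and clock contribute at most the program length each; the two flags contribute
  -- twice it, since the length is positive.
  have h₆ : Λ.stateLength ≤ 5 * Λ.length := by omega
  have h₇ : (Δ + 1) * Λ.stateLength ≤ (2 * max 1 Δ) * (5 * Λ.length) :=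
    Nat.mul_le_mul (by omega) h₆
  have h₈ : 1 * Λ.length ≤ max 1 Δ * Λ.length := Nat.mul_le_mul_right _ (le_max_left _ _)
  have h₉ : (2 * max 1 Δ) * (5 * Λ.length) = 10 * (max 1 Δ * Λ.length) := by ring
  -- The constant 40 leaves slack; these estimates already give 29.
  omega

end Simulation

end Program

/-- Taking a disjunction over the neighbours by their numbers is the same as taking it over all the
successors. -/
theorem KripkeModel.InClass.exists_isNeighbour_iff {PROP : Type} [LinearOrder PROP]
    {Sig : Finset PROP} {W : Type} {M : KripkeModel Sig W} {D : Set PROP} {Δ : ℕ}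
    (hM : M.InClass D Δ) (w : W) (p : W → Prop) :
    (∃ j : Fin Δ, ∃ v, M.IsNeighbour D w j v ∧ p v) ↔ ∃ v, M.rel w v ∧ p v := by
  constructor
  · rintro ⟨j, v, hv, hp⟩
    exact ⟨v, hv.1, hp⟩
  · rintro ⟨v, hv, hp⟩
    have := hM.finite
    -- The number of `v` counts the successors with smaller identifiers. It omits `v` itself, so it
    -- is below the out-degree and is a valid slot index.
    have hlt : {u | u ∈ M.succ w ∧ M.ident D u < M.ident D v}.ncard < (M.succ w).ncard := by
      refine Set.ncard_lt_ncard ⟨fun u hu => hu.1, fun h => ?_⟩ (Set.toFinite _)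
      exact lt_irrefl _ (h (show v ∈ M.succ w from hv)).2
    exact ⟨⟨_, hlt.trans_le (hM.outDegree w)⟩, v, ⟨hv, rfl⟩, hp⟩

namespace Program

variable {PROP VAR : Type} {Sig : Finset PROP}

/-! ### The rounds of the simulating circuit -/

/-- The bits `β'` of the state of `w` are obtained from the states `β` by one round of the
simulating circuit. -/
structure IsRound (Λ : Program VAR Sig) {W : Type} (M : KripkeModel Sig W)
    (β : W → Λ.StateBit → Prop) (w : W) (β' : Λ.StateBit → Prop) : Prop where
  top : ∀ h, β' (.inr (.inl ⟨.top, h⟩))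
  prop : ∀ p h, β' (.inr (.inl ⟨.prop p, h⟩)) ↔ w ∈ M.val p
  var : ∀ X h, β' (.inr (.inl ⟨.var X, h⟩)) ↔ β w (.inl X)
  neg : ∀ φ h, β' (.inr (.inl ⟨.neg φ, h⟩)) ↔ ¬ β' (.inr (.inl ⟨φ, mem_closure_of_neg h⟩))
  conj : ∀ φ ψ h, β' (.inr (.inl ⟨.conj φ ψ, h⟩)) ↔
    β' (.inr (.inl ⟨φ, mem_closure_of_conj_left h⟩)) ∧
      β' (.inr (.inl ⟨ψ, mem_closure_of_conj_right h⟩))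
  dia : ∀ φ h, β' (.inr (.inl ⟨.dia φ, h⟩)) ↔
    ∃ v, M.rel w v ∧ β v (.inr (.inl ⟨φ, mem_closure_of_dia h⟩))
  clock : ∀ i, β' (.inr (.inr (.inl i))) ↔
    (¬ ∀ i, β w (.inr (.inr (.inl i)))) ∧ ∀ j < i, β w (.inr (.inr (.inl j)))
  started : β' (.inr (.inr (.inr false))) ↔
    (∀ i, β w (.inr (.inr (.inl i)))) ∨ β w (.inr (.inr (.inr false)))
  attention : β' (.inr (.inr (.inr true))) ↔
    (∀ i, β w (.inr (.inr (.inl i)))) ∧ ∃ Y ∈ Λ.attention, β' (.inl Y)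
  head : ∀ Y, β' (.inl Y) ↔
    ((∀ i, β w (.inr (.inr (.inl i)))) ∧ ¬ β w (.inr (.inr (.inr false))) ∧
        β' (.inr (.inl ⟨_, Λ.terminal_mem_closure Y⟩))) ∨
      ((∀ i, β w (.inr (.inr (.inl i)))) ∧ β w (.inr (.inr (.inr false))) ∧
        β' (.inr (.inl ⟨_, Λ.iteration_mem_closure Y⟩))) ∨
      ((¬ ∀ i, β w (.inr (.inr (.inl i)))) ∧ β w (.inl Y))

section Simulation

variable [LinearOrder VAR] (Λ : Program VAR Sig) {Δ : ℕ} {W : Type} {M : KripkeModel Sig W}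

/-- The solutions of the equations of the gates compute one round. -/
theorem isRound_of_simDesc {β : W → Λ.StateBit → Prop} {w : W}
    {x : Sig ⊕ (Fin (Δ + 1) × Fin Λ.stateLength) → Prop} {v : SimGate Λ → Prop}
    (hv : ∀ g, v g ↔ (Λ.simDesc Δ g).Holds (Sum.elim x v))
    (hprop : ∀ p, x (.inl p) ↔ w ∈ M.val p)
    (hown : ∀ b, x (.inr (0, Λ.bitEquiv b)) ↔ β w b)
    (hnb : ∀ b, (∃ j : Fin Δ, x (.inr (j.succ, Λ.bitEquiv b))) ↔ ∃ u, M.rel w u ∧ β u b) :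
    Λ.IsRound M β w fun b => v (Λ.bitGate b) := by
  have htick : v .tick ↔ ∀ i, β w (.inr (.inr (.inl i))) := by
    rw [hv]
    simp [simDesc, GateDesc.Holds, ownWire, hown]
  have hntick : v .notTick ↔ ¬ v .tick := by
    rw [hv]
    simp [simDesc, GateDesc.Holds]
  constructor
  · intro h
    rw [bitGate, hv]
    simp [simDesc, subDesc, GateDesc.Holds]
  · intro p h
    rw [bitGate, hv]
    simp [simDesc, subDesc, GateDesc.Holds, hprop]
  · intro X h
    rw [bitGate, hv]
    simp [simDesc, subDesc, GateDesc.Holds, ownWire, hown]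
  · intro φ h
    rw [bitGate, hv]
    simp [simDesc, subDesc, GateDesc.Holds, bitGate]
  · intro φ ψ h
    rw [bitGate, hv]
    simp [simDesc, subDesc, GateDesc.Holds, bitGate]
  · intro φ h
    rw [bitGate, hv, ← hnb]
    simp [simDesc, subDesc, GateDesc.Holds, neighbourWire]
  · intro i
    rw [bitGate, hv, ← htick, ← hntick]
    simp [simDesc, GateDesc.Holds, ownWire, hown]
  · rw [bitGate, hv, ← htick]
    simp [simDesc, GateDesc.Holds, ownWire, hown]
  · have hany : v .anyAttention ↔ ∃ Y ∈ Λ.attention, v (.head Y) := by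
      rw [hv]
      simp [simDesc, GateDesc.Holds]
    change v .attention ↔ _ ∧ ∃ Y ∈ Λ.attention, v (.head Y)
    rw [hv, ← htick, ← hany]
    simp [simDesc, GateDesc.Holds]
  · intro Y
    have hns : v .notStarted ↔ ¬ β w (.inr (.inr (.inr false))) := by
      rw [hv]
      simp [simDesc, GateDesc.Holds, ownWire, hown]
    have ht : v (.terminal Y) ↔ v .tick ∧ v .notStarted ∧
        v (.sub ⟨_, Λ.terminal_mem_closure Y⟩) := by
      rw [hv]
      simp [simDesc, GateDesc.Holds]
    have hi : v (.iteration Y) ↔ v .tick ∧ β w (.inr (.inr (.inr false))) ∧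
        v (.sub ⟨_, Λ.iteration_mem_closure Y⟩) := by
      rw [hv]
      simp [simDesc, GateDesc.Holds, ownWire, hown]
    have hk : v (.keep Y) ↔ v .notTick ∧ β w (.inl Y) := by
      rw [hv]
      simp [simDesc, GateDesc.Holds, ownWire, hown]
    simp only [bitGate]
    rw [hv (.head Y), ← htick, ← hns, ← hntick, ← ht, ← hi, ← hk]
    simp [simDesc, GateDesc.Holds]

variable [LinearOrder PROP] {D : Set PROP}

theorem received_toMPC_succ (f : W → Fin (Λ.toMPC Δ).k → Bool) (w : W) (j : Fin Δ)
    (b : Fin (Λ.toMPC Δ).k) :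
    (Λ.toMPC Δ).received M D f w j.succ b = true ↔
      ∃ u, M.IsNeighbour D w j u ∧ f u b = true := by
  rw [MPC.received, Fin.cons_succ]
  exact @decide_eq_true_iff _ (_)

theorem isRound_run (hM : M.InClass D Δ) (f : W → Fin (Λ.toMPC Δ).k → Bool) (w : W) :
    Λ.IsRound M (fun v b => f v (Λ.bitEquiv b) = true) w fun b =>
      (Λ.toMPC Δ).circuit.run (Sum.elim (M.localInput w)
        fun jb => (Λ.toMPC Δ).received M D f w jb.1 jb.2) (Λ.bitEquiv b) = true := by
  have : Nonempty (Fin Λ.stateLength) := ⟨⟨0, Λ.stateLength_pos⟩⟩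
  obtain ⟨v, hv, hrun⟩ := (Λ.simNetlist Δ).exists_run_toCircuit
    (Sum.elim (M.localInput w) fun jb => (Λ.toMPC Δ).received M D f w jb.1 jb.2)
  have hbit : (fun b => (Λ.toMPC Δ).circuit.run (Sum.elim (M.localInput w)
      fun jb => (Λ.toMPC Δ).received M D f w jb.1 jb.2) (Λ.bitEquiv b) = true) =
        fun b => v (Λ.bitGate b) := by
    funext b
    refine propext ((hrun (Λ.bitEquiv b)).trans ?_)
    simp [simNetlist]
  rw [hbit]
  refine Λ.isRound_of_simDesc hv (fun p => @decide_eq_true_iff _ (_)) (fun b => Iff.rfl)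
    fun b => ?_
  rw [← hM.exists_isNeighbour_iff w]
  exact exists_congr fun j => Λ.received_toMPC_succ f w j _

/-- The bits of the state of `w` in the simulating circuit after `q` rounds have been computed. -/
def simBit (Δ : ℕ) (M : KripkeModel Sig W) (D : Set PROP) : ℕ → W → Λ.StateBit → Prop
  | 0, _, _ => False
  | q + 1, w, b => (Λ.toMPC Δ).config M D q w (Λ.bitEquiv b) = true

theorem isRound_simBit (hM : M.InClass D Δ) (q : ℕ) (w : W) :
    Λ.IsRound M (Λ.simBit Δ M D q) w (Λ.simBit Δ M D (q + 1) w) := by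
  cases q with
  | zero =>
    have h := Λ.isRound_run hM (fun _ _ => false) w
    -- Round zero is an ordinary round started from all-zero states: all received strings are then
    -- zero as well. Thus index `0` of `simBit` is a virtual state before the first round.
    have hr : (Λ.toMPC Δ).received M D (fun _ _ => false) w = fun _ _ => false := by
      funext j b
      refine Fin.cases rfl (fun j => ?_) j
      rw [Bool.eq_false_iff, Ne, received_toMPC_succ]
      simp
    rw [hr] at h
    simp only [Bool.false_eq_true] at h
    exact h
  | succ q => exact Λ.isRound_run hM ((Λ.toMPC Δ).config M D q) w

end Simulation

/-- The truth values of the head predicates after `n` rounds of the program have been computed. -/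
def headVal (Λ : Program VAR Sig) {W : Type} (M : KripkeModel Sig W) : ℕ → W → Λ.heads → Prop
  | 0, _, _ => False
  | n + 1, w, Y => M.Sat w (Λ.iter n Y)

/-! ### Invariants of the clock, the flags, the subschemata and the heads -/

section Invariant

variable {Λ : Program VAR Sig} {W : Type} {M : KripkeModel Sig W}
  {β : ℕ → W → Λ.StateBit → Prop}

/-- The two cases are the end of a phase, where the clock resets and the phase number grows, and a
step inside a phase. -/
theorem add_one_mod_div {q d : ℕ} :
    (q % (d + 1) = d ∧ (q + 1) % (d + 1) = 0 ∧ (q + 1) / (d + 1) = q / (d + 1) + 1) ∨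
      (q % (d + 1) < d ∧ (q + 1) % (d + 1) = q % (d + 1) + 1 ∧
        (q + 1) / (d + 1) = q / (d + 1)) := by
  have h₁ := Nat.div_add_mod q (d + 1)
  have h₂ : q % (d + 1) < d + 1 := Nat.mod_lt q (Nat.succ_pos d)
  rcases (Nat.lt_succ_iff.1 h₂).lt_or_eq with h | h
  · right
    have e : q + 1 = (q % (d + 1) + 1) + (d + 1) * (q / (d + 1)) := by omega
    refine ⟨h, ?_, ?_⟩
    · rw [e, Nat.add_mul_mod_self_left, Nat.mod_eq_of_lt (by omega)]
    · rw [e, Nat.add_mul_div_left _ _ (Nat.succ_pos d), Nat.div_eq_of_lt (by omega), zero_add]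
  · left
    have e : q + 1 = 0 + (d + 1) * (q / (d + 1) + 1) := by
      rw [mul_add]
      omega
    refine ⟨h, ?_, ?_⟩
    · rw [e, Nat.add_mul_mod_self_left, Nat.zero_mod]
    · rw [e, Nat.add_mul_div_left _ _ (Nat.succ_pos d)]
      simp

/-- The clock holds the residue of `q` in unary. Setting bit `i` exactly when all lower bits were
set lengthens the block of ones by one, and a tick clears it. -/
theorem clock_iff (h₀ : ∀ w b, ¬ β 0 w b) (hβ : ∀ q w, Λ.IsRound M (β q) w (β (q + 1) w))
    (q : ℕ) (w : W) (i : Fin Λ.modalDepth) :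
    β q w (.inr (.inr (.inl i))) ↔ i < q % (Λ.modalDepth + 1) := by
  induction q generalizing i with
  | zero => simpa using h₀ w _
  | succ q ih =>
    rw [(hβ q w).clock]
    simp only [ih]
    have hi := i.2
    rcases add_one_mod_div (q := q) (d := Λ.modalDepth) with ⟨h, h', -⟩ | ⟨h, h', -⟩
    · rw [h, h']
      simp
    · rw [h']
      constructor
      · rintro ⟨-, hj⟩
        by_contra hlt
        -- The first zero bit of the old clock has the residue as its index; a new bit beyond it
        -- would require it to be set.
        have := hj ⟨q % (Λ.modalDepth + 1), h⟩ (Fin.lt_def.2 (by simp only; omega))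
        exact lt_irrefl _ this
      · intro hlt
        refine ⟨fun hall => lt_irrefl _ (hall ⟨q % (Λ.modalDepth + 1), h⟩), fun j hj => ?_⟩
        have := Fin.lt_def.1 hj
        omega

theorem tick_iff (h₀ : ∀ w b, ¬ β 0 w b) (hβ : ∀ q w, Λ.IsRound M (β q) w (β (q + 1) w))
    (q : ℕ) (w : W) :
    (∀ i, β q w (.inr (.inr (.inl i)))) ↔ q % (Λ.modalDepth + 1) = Λ.modalDepth := by
  simp only [clock_iff h₀ hβ]
  have h₂ : q % (Λ.modalDepth + 1) < Λ.modalDepth + 1 := Nat.mod_lt q (Nat.succ_pos _)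
  constructor
  · intro h
    by_contra hne
    exact lt_irrefl _ (h ⟨q % (Λ.modalDepth + 1), by omega⟩)
  · intro h i
    rw [h]
    exact i.2

theorem started_iff (h₀ : ∀ w b, ¬ β 0 w b) (hβ : ∀ q w, Λ.IsRound M (β q) w (β (q + 1) w))
    (q : ℕ) (w : W) : β q w (.inr (.inr (.inr false))) ↔ 0 < q / (Λ.modalDepth + 1) := by
  induction q with
  | zero => simpa using h₀ w _
  | succ q ih =>
    rw [(hβ q w).started, tick_iff h₀ hβ, ih]
    rcases add_one_mod_div (q := q) (d := Λ.modalDepth) with ⟨h, -, h'⟩ | ⟨h, -, h'⟩ <;>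
      rw [h'] <;> generalize q / (Λ.modalDepth + 1) = n <;> omega

/-- One round raises the depth of correct evaluation by one. Induction on the schema handles the
connectives inside the new state; only a diamond consults the old states of the successors, where
its argument has depth below `t`. -/
theorem sub_iff (hβ : ∀ q w, Λ.IsRound M (β q) w (β (q + 1) w)) {q n t : ℕ}
    (hhead : ∀ w Y, β q w (.inl Y) ↔ Λ.headVal M n w Y)
    (hprev : ∀ w φ h, φ.modalDepth < t →
      (β q w (.inr (.inl ⟨φ, h⟩)) ↔ φ.Holds M (Λ.headVal M n) w))
    (w : W) (φ : Schema Sig Λ.heads) (h : φ ∈ Λ.closure) (hd : φ.modalDepth ≤ t) :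
    β (q + 1) w (.inr (.inl ⟨φ, h⟩)) ↔ φ.Holds M (Λ.headVal M n) w := by
  induction φ with
  | top => exact iff_of_true ((hβ q w).top h) trivial
  | prop p => exact (hβ q w).prop p h
  | var X => exact ((hβ q w).var X h).trans (hhead w X)
  | neg φ ih => exact ((hβ q w).neg φ h).trans (not_congr (ih _ hd))
  | conj φ ψ ih₁ ih₂ =>
    exact ((hβ q w).conj φ ψ h).trans
      (and_congr (ih₁ _ ((le_max_left _ _).trans hd)) (ih₂ _ ((le_max_right _ _).trans hd)))
  | dia φ _ =>
    exact ((hβ q w).dia φ h).trans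
      (exists_congr fun v => and_congr_right fun _ => hprev v φ _ hd)

/-- In the rounds of one phase, the bits of the head predicates have the values of the previous
round of the program, and the bits of the subschemata get their correct values in the order of
their modal depths. -/
theorem head_iff_and_sub_iff (h₀ : ∀ w b, ¬ β 0 w b)
    (hβ : ∀ q w, Λ.IsRound M (β q) w (β (q + 1) w)) (q : ℕ) :
    (∀ w Y, β q w (.inl Y) ↔ Λ.headVal M (q / (Λ.modalDepth + 1)) w Y) ∧
      ∀ w φ h, φ.modalDepth < q % (Λ.modalDepth + 1) → (β q w (.inr (.inl ⟨φ, h⟩)) ↔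
        φ.Holds M (Λ.headVal M (q / (Λ.modalDepth + 1))) w) := by
  induction q with
  | zero => exact ⟨fun w Y => by simpa [headVal] using h₀ w _, by simp⟩
  | succ q ih =>
    have hsub := sub_iff hβ ih.1 ih.2
    have hround := fun w => (hβ q w).head
    simp only [tick_iff h₀ hβ, started_iff h₀ hβ, ih.1] at hround
    rcases add_one_mod_div (q := q) (d := Λ.modalDepth) with ⟨h, h', h''⟩ | ⟨h, h', h''⟩
    · refine ⟨fun w Y => ?_, fun w φ _ hφ => absurd hφ (by rw [h']; exact Nat.not_lt_zero _)⟩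
      -- At the tick the residue equals the modal depth of the program, so all clause bodies are
      -- correct in the very round in which the head gates read them.
      have ht := hsub w _ (Λ.terminal_mem_closure Y)
        (by rw [h, Schema.modalDepth_ofML]; exact Λ.terminal_modalDepth_le Y)
      have hi := hsub w _ (Λ.iteration_mem_closure Y) (by rw [h]; exact Λ.iteration_modalDepth_le Y)
      rw [hround, h'', ht, hi, h, Schema.holds_ofML]
      -- Phase zero has the flag unset and selects the terminal clause; every later phase selects
      -- the iteration clause.
      cases q / (Λ.modalDepth + 1) with
      | zero => simp [headVal, iter]
      | succ n =>
        have : Λ.headVal M (n + 1 + 1) w Y ↔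
            (Λ.iteration Y).Holds M (Λ.headVal M (n + 1)) w := Schema.sat_subst M _ w _
        simp [this]
    · rw [h', h'']
      refine ⟨fun w Y => ?_, fun w φ hc hφ => hsub w φ hc (Nat.lt_succ_iff.1 hφ)⟩
      rw [hround]
      simp [h.ne]

/-- The attention gate reads the freshly computed heads, so attention and printed bits belong to the
same state. -/
theorem attention_iff (h₀ : ∀ w b, ¬ β 0 w b) (hβ : ∀ q w, Λ.IsRound M (β q) w (β (q + 1) w))
    (q : ℕ) (w : W) : β (q + 1) w (.inr (.inr (.inr true))) ↔
      q % (Λ.modalDepth + 1) = Λ.modalDepth ∧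
        ∃ Y ∈ Λ.attention, Λ.headVal M ((q + 1) / (Λ.modalDepth + 1)) w Y := by
  rw [(hβ q w).attention, tick_iff h₀ hβ]
  simp only [(head_iff_and_sub_iff h₀ hβ (q + 1)).1]

end Invariant

end Program

/-! ### Output of the simulating circuit -/

/-- The later of two distinct rounds would contradict the minimality built into acceptance. -/
theorem AcceptsInRound.unique {I : Type} {S : ℕ → I → Bool} {A : Finset I} {n n' : ℕ}
    (h : AcceptsInRound S A n) (h' : AcceptsInRound S A n') : n = n' := by
  obtain ⟨⟨i, hi, ht⟩, hmin⟩ := h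
  obtain ⟨⟨i', hi', ht'⟩, hmin'⟩ := h'
  rcases lt_trichotomy n n' with hlt | rfl | hlt
  · simp [hmin' n hlt i hi] at ht
  · rfl
  · simp [hmin n' hlt i' hi'] at ht'

theorem substring_map {I J : Type} [LinearOrder I] [LinearOrder J] (f : I ↪ J)
    (hf : StrictMono f) (P : Finset I) (b : J → Bool) :
    substring (P.map f) b = substring P fun i => b (f i) := by
  have h := Finset.map_sort (r := (· ≤ ·)) (r' := (· ≤ ·)) f P fun a _ b _ => hf.le_iff_le.symm
  rw [substring, ← h, List.map_map]
  rfl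

/-- A sequence that repeats the attention of another one, slowed down by the factor `d + 1`,
accepts in the corresponding round. -/
theorem acceptsInRound_slowdown {I J : Type} {S : ℕ → I → Bool} {S' : ℕ → J → Bool}
    {A : Finset I} {A' : Finset J} {d : ℕ}
    (h : ∀ r, (∃ j ∈ A', S' r j = true) ↔
      ∃ n, r = n * (d + 1) + d ∧ ∃ i ∈ A, S n i = true) (r : ℕ) :
    AcceptsInRound S' A' r ↔ ∃ n, r = n * (d + 1) + d ∧ AcceptsInRound S A n := by
  have aux : ∀ (K : Type) (f : K → Bool) (B : Finset K),
      (∀ i ∈ B, f i = false) ↔ ¬ ∃ i ∈ B, f i = true := by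
    simp
  simp only [AcceptsInRound, aux, h]
  constructor
  · rintro ⟨⟨n, rfl, hn⟩, hmin⟩
    refine ⟨n, rfl, hn, fun m hm hex => hmin (m * (d + 1) + d) ?_ ⟨m, rfl, hex⟩⟩
    have := Nat.mul_lt_mul_of_pos_right hm (Nat.succ_pos d)
    exact Nat.add_lt_add_right this d
  · rintro ⟨n, rfl, hn, hmin⟩
    refine ⟨⟨n, rfl, hn⟩, ?_⟩
    rintro _ hm ⟨m, rfl, hex⟩
    exact hmin m (Nat.lt_of_mul_lt_mul_right (Nat.lt_of_add_lt_add_right hm)) hex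

namespace Program

variable {PROP VAR : Type} {Sig : Finset PROP} [LinearOrder PROP] [LinearOrder VAR]
  (Λ : Program VAR Sig) {Δ : ℕ} {W : Type} {M : KripkeModel Sig W} {D : Set PROP}

theorem config_toMPC_head (hM : M.InClass D Δ) (n : ℕ) (w : W) (Y : Λ.heads) :
    (Λ.toMPC Δ).config M D (n * (Λ.modalDepth + 1) + Λ.modalDepth) w (Λ.bitEquiv (.inl Y)) =
      Λ.config M n w Y := by
  have h := (head_iff_and_sub_iff (β := Λ.simBit Δ M D) (fun _ _ => id) (Λ.isRound_simBit hM)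
    (n * (Λ.modalDepth + 1) + Λ.modalDepth + 1)).1 w Y
  rw [show n * (Λ.modalDepth + 1) + Λ.modalDepth + 1 = (n + 1) * (Λ.modalDepth + 1) by ring,
    Nat.mul_div_cancel _ (Nat.succ_pos _)] at h
  rw [Bool.eq_iff_iff, config, @decide_eq_true_iff _ (_)]
  -- Restoring the successor form lets `simBit` unfold to the configuration one round earlier.
  rw [← show n * (Λ.modalDepth + 1) + Λ.modalDepth + 1 = (n + 1) * (Λ.modalDepth + 1) by ring] at h
  exact h

theorem config_toMPC_attention (hM : M.InClass D Δ) (r : ℕ) (w : W) :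
    (Λ.toMPC Δ).config M D r w (Λ.bitEquiv (.inr (.inr (.inr true)))) = true ↔
      ∃ n, r = n * (Λ.modalDepth + 1) + Λ.modalDepth ∧
        ∃ Y ∈ Λ.attention, Λ.config M n w Y = true := by
  have h := attention_iff (β := Λ.simBit Δ M D) (fun _ _ => id) (Λ.isRound_simBit hM) r w
  refine h.trans ?_
  simp only [config, decide_eq_true_iff]
  constructor
  · rintro ⟨hr, Y, hY, hv⟩
    have e := Nat.div_add_mod r (Λ.modalDepth + 1)
    rcases add_one_mod_div (q := r) (d := Λ.modalDepth) with ⟨-, -, h'⟩ | ⟨h', -, -⟩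
    · rw [h'] at hv
      exact ⟨r / (Λ.modalDepth + 1), by rw [mul_comm]; omega, Y, hY, hv⟩
    · omega
  · rintro ⟨n, rfl, Y, hY, hv⟩
    refine ⟨?_, Y, hY, ?_⟩
    · rw [add_comm, Nat.add_mul_mod_self_right, Nat.mod_eq_of_lt (Nat.lt_succ_self _)]
    · rw [show n * (Λ.modalDepth + 1) + Λ.modalDepth + 1 = (n + 1) * (Λ.modalDepth + 1) by ring,
        Nat.mul_div_cancel _ (Nat.succ_pos _)]
      exact hv

/-- The attention rounds are those of the program under the slowdown, and at such rounds the print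
bits agree with the print predicates. Equivalence and the time bound both follow from this. -/
theorem outputs_toMPC_iff (hM : M.InClass D Δ) (w : W) (r : ℕ) (s : List Bool) :
    (Λ.toMPC Δ).Outputs M D w r s ↔
      ∃ n, r = n * (Λ.modalDepth + 1) + Λ.modalDepth ∧ Λ.Outputs M w n s := by
  have hacc := acceptsInRound_slowdown (S := fun t => Λ.config M t w)
    (S' := fun t => (Λ.toMPC Δ).config M D t w) (A := Λ.attention) (A' := (Λ.toMPC Δ).attention)
    (d := Λ.modalDepth) (fun r => by
      rw [← Λ.config_toMPC_attention hM r w]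
      exact ⟨fun ⟨_, hj, h⟩ => Finset.mem_singleton.1 hj ▸ h,
        fun h => ⟨_, Finset.mem_singleton_self _, h⟩⟩) r
  have hprint : ∀ n, substring (Λ.toMPC Δ).print
      ((Λ.toMPC Δ).config M D (n * (Λ.modalDepth + 1) + Λ.modalDepth) w) =
        substring Λ.print (Λ.config M n w) := fun n => by
    refine (substring_map _ Λ.bitEquiv_inl_strictMono _ _).trans ?_
    exact congrArg _ (funext fun Y => Λ.config_toMPC_head hM n w Y)
  simp only [MPC.Outputs, OutputsInRound, Outputs, hacc]
  constructor
  · rintro ⟨⟨n, rfl, hn⟩, rfl⟩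
    exact ⟨n, rfl, hn, hprint n⟩
  · rintro ⟨n, rfl, hn, rfl⟩
    exact ⟨⟨n, rfl, hn⟩, (hprint n).symm⟩

variable (Δ D)

theorem equivalent_toMPC : Equivalent D Λ (Λ.toMPC Δ) := by
  intro W M hM w s
  simp only [Λ.outputs_toMPC_iff hM]
  constructor
  · rintro ⟨n, hn⟩
    exact ⟨_, n, rfl, hn⟩
  · rintro ⟨_, n, -, hn⟩
    exact ⟨n, hn⟩

theorem timeFactorAtMost_toMPC :
    TimeFactorAtMost D Λ (Λ.toMPC Δ) (2 * max 1 Λ.modalDepth) := by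
  intro W M hM w n n' s s' hn hn'
  obtain ⟨m, rfl, hm⟩ := (Λ.outputs_toMPC_iff hM w n' s').1 hn'
  -- The program accepts in at most one round, so the circuit's output simulates the given round
  -- `n`.
  obtain rfl : n = m := hn.1.unique hm.1
  calc n * (Λ.modalDepth + 1) + Λ.modalDepth + 1 = (Λ.modalDepth + 1) * (n + 1) := by ring
    _ ≤ 2 * max 1 Λ.modalDepth * (n + 1) := Nat.mul_le_mul_right _ (by omega)

end Program

end MSC

theorem mainTheorem2 :
    ∃ c₁ c₂ : ℕ, ∀ (PROP VAR : Type) [LinearOrder PROP] [LinearOrder VAR]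
      (D : Set PROP) (Sig : Finset PROP) (Δ : ℕ) (Λ : MSC.Program VAR Sig),
      ∃ C : MSC.MPC Sig Δ,
        MSC.Equivalent D Λ C ∧
        C.size ≤ c₁ * (max 1 Δ * Λ.length + Sig.card) ∧
        MSC.TimeFactorAtMost D Λ C (c₂ * max 1 Λ.modalDepth) :=
  ⟨40, 2, fun _ _ _ _ D _ Δ Λ => ⟨Λ.toMPC Δ, Λ.equivalent_toMPC Δ D, Λ.size_toMPC_le Δ,
    Λ.timeFactorAtMost_toMPC Δ D⟩⟩
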